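/- Let $d\ge 1$ and $\alpha\in(0,2]$. A geometric $\alpha$-stable process on $\mathbb R^d$ is a Lévy process $L=(L_t)_{t\ge0}$ started at $0$, defined on some probability space, with symbol $\psi(\xi)=\log(1+|\xi|^\alpha)$, that is, $\mathbb E[e^{i\langle \xi,L_t\rangle}]=e^{-t\psi(\xi)}=(1+|\xi|^\alpha)^{-t}$ for all $t\ge0$ and $\xi\in\mathbb R^d$. For $x\in\mathbb R^d$ put $X_t=x+L_t$. Then the geometric $\alpha$-stable process has a transition density with respect to Lebesgue measure: there are nonnegative Borel functions $p_t$, $t>0$, on $\mathbb R^d$ such that for every $t>0$ 1. $p_t(y)\,dy$ is a probability measure with Fourier transform $\xi\mapsto(1+|\xi|^\alpha)^{-t}$, and 2. for every geometric $\alpha$-stable process $L$ and every $x\in\mathbb R^d$, the law of $X_t=x+L_t$ is $p_t(y-x)\,dy$. This includes the times $0<t\le d/\alpha$, for which the characteristic function $\xi\mapsto(1+|\xi|^\alpha)^{-t}$ is not integrable on $\mathbb R^d$. -/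

import Mathlib

open MeasureTheory ProbabilityTheory Filter Topology
open scoped NNReal ENNReal

/-- A process `L` indexed by `[0, ∞)`, with values in `ℝ^d`, is a Lévy process starting at `0` on
the probability space `(Ω, P)`: the increments are independent and stationary, the process starts
at `0`, is continuous in probability, and almost every path is right continuous with left limits
(at time `0` the left-limit condition is trivial). -/
structure IsLevyProcess {d : ℕ} {Ω : Type*} [MeasurableSpace Ω]
    (L : ℝ≥0 → Ω → EuclideanSpace ℝ (Fin d)) (P : Measure Ω) : Prop where
  isProbabilityMeasure : IsProbabilityMeasure P
  measurable : ∀ t, Measurable (L t)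
  start : ∀ᵐ ω ∂P, L 0 ω = 0
  indep_increments : HasIndepIncrements L P
  stationary_increments : ∀ s h,
    IdentDistrib (fun ω ↦ L (s + h) ω - L s ω) (fun ω ↦ L h ω - L 0 ω) P P
  continuous_in_measure : ∀ t, TendstoInMeasure P L (𝓝 t) (L t)
  cadlag : ∀ᵐ ω ∂P, ∀ t, ContinuousWithinAt (fun s ↦ L s ω) (Set.Ici t) t ∧
    ∃ l, Tendsto (fun s ↦ L s ω) (𝓝[<] t) (𝓝 l)

/-- `ψ` is the symbol (characteristic exponent) of `L`:
`E[exp(i⟨ξ, L_t⟩)] = exp(-t ψ(ξ))` for all `t ≥ 0` and `ξ`. -/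
def HasSymbol {d : ℕ} {Ω : Type*} [MeasurableSpace Ω]
    (L : ℝ≥0 → Ω → EuclideanSpace ℝ (Fin d)) (P : Measure Ω)
    (ψ : EuclideanSpace ℝ (Fin d) → ℂ) : Prop :=
  ∀ (t : ℝ≥0) (ξ : EuclideanSpace ℝ (Fin d)),
    charFun (P.map (L t)) ξ = Complex.exp (-((t : ℝ) : ℂ) * ψ ξ)

/-- The symbol `ψ(ξ) = log(1 + |ξ|^α)`. -/
noncomputable def geometricStableSymbol (d : ℕ) (α : ℝ) (ξ : EuclideanSpace ℝ (Fin d)) : ℝ :=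
  Real.log (1 + ‖ξ‖ ^ α)

/-- `L` is a geometric `α`-stable process on `ℝ^d`, started at `0`. -/
structure IsGeometricStableProcess {d : ℕ} {Ω : Type*} [MeasurableSpace Ω] (α : ℝ)
    (L : ℝ≥0 → Ω → EuclideanSpace ℝ (Fin d)) (P : Measure Ω) : Prop where
  isLevyProcess : IsLevyProcess L P
  hasSymbol : HasSymbol L P (fun ξ ↦ (geometricStableSymbol d α ξ : ℂ))

/-!
Subordination: if `G` has the Gamma law of shape `t`, `S` is one-sided `α / 2`-stable and `N` is
standard Gaussian, all independent, then `√(2 G ^ (2 / α) S) • N` has characteristic function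
`ξ ↦ (1 + ‖ξ‖ ^ α) ^ (-t)`. Being a mixture of nondegenerate Gaussian laws, it has a density for
every `t > 0`, so Fourier inversion, which breaks down for small `t`, is not needed. The one-sided
stable law is a limit of normalized sums of Sibuya variables, whose generating function
`1 - (1 - s) ^ b` already carries the exponent `b = α / 2`.
-/

/-- On `[0, ∞)`, the function `f` is the Laplace transform of a probability measure carried by the
open half-line `(0, ∞)`. An atom at `0` is excluded so that Gaussian mixtures have a density. -/
def IsLaplaceTransform (f : ℝ → ℝ) : Prop :=
  ∃ μ : Measure ℝ, IsProbabilityMeasure μ ∧ (∀ᵐ u ∂μ, 0 < u) ∧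
    ∀ l, 0 ≤ l → ∫ u, Real.exp (-(l * u)) ∂μ = f l

lemma integrable_exp_neg_mul {Ω : Type*} [MeasurableSpace Ω] {P : Measure Ω} [IsFiniteMeasure P]
    {X : Ω → ℝ} (hX : AEMeasurable X P) (hX₀ : ∀ᵐ ω ∂P, 0 ≤ X ω) {l : ℝ} (hl : 0 ≤ l) :
    Integrable (fun ω ↦ Real.exp (-(l * X ω))) P := by
  refine Integrable.of_bound (C := 1) (by fun_prop) ?_
  filter_upwards [hX₀] with ω hω
  rw [Real.norm_of_nonneg (Real.exp_nonneg _), Real.exp_le_one_iff]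
  exact neg_nonpos.2 (mul_nonneg hl hω)

lemma isLaplaceTransform_of_integral {Ω : Type*} [MeasurableSpace Ω] {P : Measure Ω}
    [IsProbabilityMeasure P] {X : Ω → ℝ} (hX : AEMeasurable X P) (hX₀ : ∀ᵐ ω ∂P, 0 < X ω)
    {f : ℝ → ℝ} (hf : ∀ l, 0 ≤ l → ∫ ω, Real.exp (-(l * X ω)) ∂P = f l) :
    IsLaplaceTransform f := by
  refine ⟨P.map X, Measure.isProbabilityMeasure_map hX,
    (ae_map_iff hX measurableSet_Ioi).2 hX₀, fun l hl ↦ ?_⟩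
  rw [integral_map hX (by fun_prop), hf l hl]

namespace IsLaplaceTransform

lemma apply_zero {f : ℝ → ℝ} (hf : IsLaplaceTransform f) : f 0 = 1 := by
  obtain ⟨μ, _, -, hμ⟩ := hf
  simp [← hμ 0 le_rfl]

lemma comp_mul_left {f : ℝ → ℝ} (hf : IsLaplaceTransform f) {c : ℝ} (hc : 0 < c) :
    IsLaplaceTransform fun l ↦ f (c * l) := by
  obtain ⟨μ, _, hμ₀, hμ⟩ := hf
  refine isLaplaceTransform_of_integral (P := μ) (X := fun u ↦ c * u) (by fun_prop) ?_
    fun l hl ↦ ?_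
  · filter_upwards [hμ₀] with u hu using mul_pos hc hu
  · simp_rw [← mul_assoc, mul_comm l c]
    exact hμ _ (by positivity)

lemma mul {f g : ℝ → ℝ} (hf : IsLaplaceTransform f) (hg : IsLaplaceTransform g) :
    IsLaplaceTransform fun l ↦ f l * g l := by
  obtain ⟨μ, _, hμ₀, hμ⟩ := hf
  obtain ⟨ν, _, hν₀, hν⟩ := hg
  refine isLaplaceTransform_of_integral (P := μ.prod ν) (X := fun q ↦ q.1 + q.2) (by fun_prop) ?_
    fun l hl ↦ ?_
  · filter_upwards [Measure.quasiMeasurePreserving_fst.ae hμ₀,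
      Measure.quasiMeasurePreserving_snd.ae hν₀] with q h₁ h₂ using add_pos h₁ h₂
  · simp_rw [mul_add, neg_add, Real.exp_add]
    rw [integral_prod_mul (fun u ↦ Real.exp (-(l * u))) fun u ↦ Real.exp (-(l * u)),
      hμ l hl, hν l hl]

lemma pow {f : ℝ → ℝ} (hf : IsLaplaceTransform f) {n : ℕ} (hn : n ≠ 0) :
    IsLaplaceTransform fun l ↦ f l ^ n := by
  obtain ⟨n, rfl⟩ := Nat.exists_eq_succ_of_ne_zero hn
  clear hn
  induction n with
  | zero => simpa using hf
  | succ n ih => simpa only [pow_succ _ (n + 1)] using ih.mul hf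

end IsLaplaceTransform

/-! ### Limits of Laplace transforms -/

lemma continuous_unitInterval_rpow {l : ℝ} (hl : 0 ≤ l) :
    Continuous fun x : unitInterval ↦ (x : ℝ) ^ l :=
  continuous_subtype_val.rpow_const fun _ ↦ Or.inr hl

lemma norm_unitInterval_rpow_le_one (x : unitInterval) {l : ℝ} (hl : 0 ≤ l) :
    ‖(x : ℝ) ^ l‖ ≤ 1 := by
  rw [Real.norm_of_nonneg (Real.rpow_nonneg x.2.1 l)]
  exact Real.rpow_le_one x.2.1 x.2.2 hl

lemma tendsto_integral_rpow_nhdsGT_zero (κ : Measure unitInterval) [IsFiniteMeasure κ] :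
    Tendsto (fun l : ℝ ↦ ∫ x : unitInterval, (x : ℝ) ^ l ∂κ) (𝓝[>] 0) (𝓝 (κ.real {0}ᶜ)) := by
  rw [← integral_indicator_one (measurableSet_singleton 0).compl]
  refine tendsto_integral_filter_of_dominated_convergence (fun _ ↦ 1) ?_ ?_
    (integrable_const _) (ae_of_all _ fun x ↦ ?_)
  · filter_upwards [self_mem_nhdsWithin] with l (hl : 0 < l)
      using (continuous_unitInterval_rpow hl.le).aestronglyMeasurable
  · filter_upwards [self_mem_nhdsWithin] with l (hl : 0 < l)
      using ae_of_all _ fun x ↦ norm_unitInterval_rpow_le_one x hl.le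
  · rcases eq_or_ne x 0 with rfl | hx
    · refine tendsto_const_nhds.congr' ?_
      filter_upwards [self_mem_nhdsWithin] with l (hl : 0 < l)
      simp [Real.zero_rpow hl.ne']
    · have hx' : (x : ℝ) ≠ 0 := unitInterval.coe_ne_zero.2 hx
      simpa [hx] using (Real.continuousAt_const_rpow hx' (b := 0)).tendsto.mono_left
        (nhdsWithin_le_nhds (s := Set.Ioi 0))

lemma tendsto_integral_rpow_atTop (κ : Measure unitInterval) [IsFiniteMeasure κ] :
    Tendsto (fun l : ℝ ↦ ∫ x : unitInterval, (x : ℝ) ^ l ∂κ) atTop (𝓝 (κ.real {1})) := by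
  rw [← integral_indicator_one (measurableSet_singleton 1)]
  refine tendsto_integral_filter_of_dominated_convergence (fun _ ↦ 1) ?_ ?_
    (integrable_const _) (ae_of_all _ fun x ↦ ?_)
  · filter_upwards [eventually_ge_atTop 0] with l hl
      using (continuous_unitInterval_rpow hl).aestronglyMeasurable
  · filter_upwards [eventually_ge_atTop 0] with l hl
      using ae_of_all _ fun x ↦ norm_unitInterval_rpow_le_one x hl
  · rcases eq_or_ne x 1 with rfl | hx
    · simp
    · have hx' : (x : ℝ) < 1 := unitInterval.lt_one_iff_ne_one.2 hx
      simpa [hx] using tendsto_rpow_atTop_of_base_lt_one (x : ℝ) (by linarith [x.2.1]) hx'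

lemma IsLaplaceTransform.exists_integral_rpow_eq {f : ℝ → ℝ} (hf : IsLaplaceTransform f) :
    ∃ κ : ProbabilityMeasure unitInterval,
      ∀ l, 0 ≤ l → ∫ x : unitInterval, (x : ℝ) ^ l ∂(κ : Measure unitInterval) = f l := by
  obtain ⟨μ, _, hμ₀, hμ⟩ := hf
  let φ : ℝ → unitInterval := fun u ↦ ⟨Real.exp (-|u|), by positivity, by simp⟩
  have hφ : Measurable φ := Measurable.subtype_mk (by fun_prop)
  refine ⟨⟨μ.map φ, Measure.isProbabilityMeasure_map hφ.aemeasurable⟩, fun l hl ↦ ?_⟩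
  rw [ProbabilityMeasure.coe_mk, integral_map hφ.aemeasurable
    (continuous_unitInterval_rpow hl).aestronglyMeasurable, ← hμ l hl]
  refine integral_congr_ae ?_
  filter_upwards [hμ₀] with u hu
  rw [← Real.exp_mul, abs_of_pos hu]
  ring_nf

lemma isLaplaceTransform_of_integral_rpow {κ : Measure unitInterval} [IsProbabilityMeasure κ]
    (h₀ : ∀ᵐ x ∂κ, x ≠ 0) (h₁ : ∀ᵐ x ∂κ, x ≠ 1) {f : ℝ → ℝ}
    (hf : ∀ l, 0 ≤ l → ∫ x : unitInterval, (x : ℝ) ^ l ∂κ = f l) :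
    IsLaplaceTransform f := by
  refine isLaplaceTransform_of_integral (P := κ) (X := fun x ↦ -Real.log x) (by fun_prop) ?_
    fun l hl ↦ ?_
  · filter_upwards [h₀, h₁] with x hx₀ hx₁
    exact neg_pos.2 (Real.log_neg (unitInterval.pos_iff_ne_zero.2 hx₀)
      (unitInterval.lt_one_iff_ne_one.2 hx₁))
  · rw [← hf l hl]
    refine integral_congr_ae ?_
    filter_upwards [h₀] with x hx₀
    rw [Real.rpow_def_of_pos (unitInterval.pos_iff_ne_zero.2 hx₀)]
    ring_nf

/-- The substitution `x = exp (-u)` turns Laplace transforms into moments on the compact space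
`[0, 1]`; the behaviour of the limit at `0` and `∞` excludes mass at the two end points. -/
lemma isLaplaceTransform_of_tendsto {f : ℕ → ℝ → ℝ} {g : ℝ → ℝ}
    (hf : ∀ n, IsLaplaceTransform (f n))
    (hfg : ∀ l, 0 ≤ l → Tendsto (fun n ↦ f n l) atTop (𝓝 (g l)))
    (hg₀ : ContinuousWithinAt g (Set.Ioi 0) 0) (hg : Tendsto g atTop (𝓝 0)) :
    IsLaplaceTransform g := by
  choose κ hκ using fun n ↦ (hf n).exists_integral_rpow_eq
  obtain ⟨ρ, φ, hφ, hρ⟩ := CompactSpace.tendsto_subseq κ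
  have hmoment (l : ℝ) (hl : 0 ≤ l) : ∫ x : unitInterval, (x : ℝ) ^ l ∂ρ = g l := by
    have h := ProbabilityMeasure.tendsto_iff_forall_integral_tendsto.1 hρ
      (BoundedContinuousFunction.mkOfCompact ⟨_, continuous_unitInterval_rpow hl⟩)
    exact tendsto_nhds_unique h
      (((hfg l hl).comp hφ.tendsto_atTop).congr fun n ↦ (hκ (φ n) l hl).symm)
  have hg_zero : g 0 = 1 :=
    tendsto_nhds_unique (hfg 0 le_rfl) (by simp [(hf _).apply_zero])
  have hρ_zero : (ρ : Measure unitInterval).real {0}ᶜ = 1 := by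
    rw [← hg_zero]
    refine tendsto_nhds_unique (tendsto_integral_rpow_nhdsGT_zero ρ) (hg₀.tendsto.congr' ?_)
    filter_upwards [self_mem_nhdsWithin] with l (hl : 0 < l) using (hmoment l hl.le).symm
  have hρ_one : (ρ : Measure unitInterval).real {1} = 0 := by
    refine tendsto_nhds_unique (tendsto_integral_rpow_atTop ρ) (hg.congr' ?_)
    filter_upwards [eventually_ge_atTop 0] with l hl using (hmoment l hl).symm
  refine isLaplaceTransform_of_integral_rpow ?_ ?_ hmoment
  · have hcompl := probReal_compl_eq_one_sub (μ := (ρ : Measure unitInterval))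
      (measurableSet_singleton 0)
    have hzero : (ρ : Measure unitInterval).real {0} = 0 := by linarith
    exact compl_mem_ae_iff.2 ((measureReal_eq_zero_iff).1 hzero)
  · exact compl_mem_ae_iff.2 ((measureReal_eq_zero_iff).1 hρ_one)

/-! ### One-sided stable laws -/

lemma isLaplaceTransform_of_hasSum {w x : ℕ → ℝ} (hw : ∀ k, 0 ≤ w k) (hw₁ : HasSum w 1)
    (hx : ∀ k, 0 < x k) {f : ℝ → ℝ}
    (hf : ∀ l, 0 ≤ l → HasSum (fun k ↦ w k * Real.exp (-(l * x k))) (f l)) :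
    IsLaplaceTransform f := by
  have hsum : ∑' k, ENNReal.ofReal (w k) = 1 := by
    rw [← ENNReal.ofReal_tsum_of_nonneg hw hw₁.summable, hw₁.tsum_eq, ENNReal.ofReal_one]
  let p : PMF ℕ := ⟨fun k ↦ ENNReal.ofReal (w k), hsum ▸ ENNReal.summable.hasSum⟩
  have hp (k : ℕ) : (p k).toReal = w k := ENNReal.toReal_ofReal (hw k)
  refine isLaplaceTransform_of_integral (P := p.toMeasure) (X := x) (by fun_prop)
    (ae_of_all _ hx) fun l hl ↦ ?_
  rw [PMF.integral_eq_tsum _ _ (integrable_exp_neg_mul (by fun_prop)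
    (ae_of_all _ fun k ↦ (hx k).le) hl)]
  simp only [hp, smul_eq_mul, (hf l hl).tsum_eq]

/-- The mass at `k + 1` of the Sibuya law of parameter `b`, the law on the positive integers with
generating function `1 - (1 - s) ^ b`. -/
noncomputable def sibuyaWeight (b : ℝ) (k : ℕ) : ℝ := (-1) ^ k * Ring.choose b (k + 1)

lemma sibuyaWeight_zero (b : ℝ) : sibuyaWeight b 0 = b := by
  simp [sibuyaWeight]

lemma sibuyaWeight_succ (b : ℝ) (k : ℕ) :
    sibuyaWeight b (k + 1) = (k + 1 - b) / (k + 2) * sibuyaWeight b k := by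
  have hchoose : (k + 2).choose (k + 1) = k + 2 := Nat.choose_succ_self_right (k + 1)
  have h : ((k : ℝ) + 2) * Ring.choose b (k + 2) = Ring.choose b (k + 1) * (b - (k + 1)) := by
    simpa [hchoose, add_assoc, one_add_one_eq_two] using
      Ring.choose_smul_choose b (Nat.le_succ (k + 1))
  have hk : (k : ℝ) + 2 ≠ 0 := by positivity
  rw [sibuyaWeight, sibuyaWeight, div_mul_eq_mul_div, eq_div_iff hk]
  linear_combination (-1) ^ (k + 1) * h

lemma sibuyaWeight_nonneg {b : ℝ} (hb : 0 ≤ b) (hb₁ : b ≤ 1) (k : ℕ) : 0 ≤ sibuyaWeight b k := by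
  induction k with
  | zero => rwa [sibuyaWeight_zero]
  | succ k ih =>
    rw [sibuyaWeight_succ]
    have : 0 ≤ (k : ℝ) + 1 - b := by linarith [k.cast_nonneg (α := ℝ)]
    positivity

lemma hasSum_sibuyaWeight_mul_pow (b : ℝ) {s : ℝ} (hs : |s| < 1) :
    HasSum (fun k ↦ sibuyaWeight b k * s ^ (k + 1)) (1 - (1 - s) ^ b) := by
  have h : HasSum (fun n ↦ Ring.choose b n * (-s) ^ n) ((1 - s) ^ b) := by
    have hs' : -s ∈ Metric.eball (0 : ℝ) 1 := by
      rw [← ENNReal.ofReal_one, Metric.eball_ofReal]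
      simpa using hs
    simpa [binomialSeries, FormalMultilinearSeries.coeff_ofScalars, mul_comm, sub_eq_add_neg]
      using (Real.one_add_rpow_hasFPowerSeriesOnBall_zero (a := b)).hasSum_sub hs'
  have h' := ((hasSum_nat_add_iff' 1).2 h).neg
  simp only [Finset.sum_range_one, Ring.choose_zero_right, pow_zero, mul_one, neg_sub] at h'
  refine h'.congr_fun fun k ↦ ?_
  rw [sibuyaWeight, neg_pow s, pow_succ]
  ring

lemma hasSum_sibuyaWeight {b : ℝ} (hb : 0 < b) (hb₁ : b ≤ 1) : HasSum (sibuyaWeight b) 1 := by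
  have hw := sibuyaWeight_nonneg hb.le hb₁
  have habs : ∀ᶠ s : ℝ in 𝓝[<] 1, 0 ≤ s ∧ |s| < 1 := by
    filter_upwards [Ioo_mem_nhdsLT zero_lt_one] with s hs
      using ⟨hs.1.le, abs_lt.2 ⟨by linarith [hs.1], hs.2⟩⟩
  have hpartial (n : ℕ) : ∑ k ∈ Finset.range n, sibuyaWeight b k ≤ 1 := by
    have hcont : Continuous fun s : ℝ ↦ ∑ k ∈ Finset.range n, sibuyaWeight b k * s ^ (k + 1) := by
      fun_prop
    refine le_of_tendsto (x := 𝓝[<] 1) (f := fun s ↦ ∑ k ∈ Finset.range n,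
      sibuyaWeight b k * s ^ (k + 1)) ?_ ?_
    · simpa using (hcont.tendsto 1).mono_left nhdsWithin_le_nhds
    · filter_upwards [habs] with s ⟨hs₀, hs₁⟩
      refine (sum_le_hasSum _ (fun k _ ↦ mul_nonneg (hw k) (by positivity))
        (hasSum_sibuyaWeight_mul_pow b hs₁)).trans ?_
      linarith [Real.rpow_nonneg (sub_nonneg.2 (abs_le.1 hs₁.le).2) b]
  have hsum : Summable (sibuyaWeight b) := summable_of_sum_range_le hw hpartial
  have hlim : Tendsto (fun s : ℝ ↦ 1 - (1 - s) ^ b) (𝓝[<] 1) (𝓝 1) := by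
    have hcont : Continuous fun s : ℝ ↦ 1 - (1 - s) ^ b := by
      have := Real.continuous_rpow_const hb.le
      fun_prop
    simpa [Real.zero_rpow hb.ne'] using (hcont.tendsto 1).mono_left (nhdsWithin_le_nhds)
  have hge : 1 ≤ ∑' k, sibuyaWeight b k := by
    refine le_of_tendsto hlim ?_
    filter_upwards [habs] with s ⟨hs₀, hs₁⟩
    refine hasSum_le (fun k ↦ ?_) (hasSum_sibuyaWeight_mul_pow b hs₁) hsum.hasSum
    exact mul_le_of_le_one_right (hw k) (pow_le_one₀ hs₀ (abs_le.1 hs₁.le).2)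
  exact le_antisymm (hsum.tsum_le_of_sum_range_le hpartial) hge ▸ hsum.hasSum

lemma isLaplaceTransform_sibuya {b : ℝ} (hb : 0 < b) (hb₁ : b ≤ 1) :
    IsLaplaceTransform fun l ↦ 1 - (1 - Real.exp (-l)) ^ b := by
  have h₁ := hasSum_sibuyaWeight hb hb₁
  refine isLaplaceTransform_of_hasSum (sibuyaWeight_nonneg hb.le hb₁) h₁
    (x := fun k ↦ ((k + 1 : ℕ) : ℝ)) (fun k ↦ by positivity) fun l hl ↦ ?_
  rcases hl.eq_or_lt with rfl | hl
  · simpa [Real.zero_rpow hb.ne'] using h₁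
  · have hexp : |Real.exp (-l)| < 1 := by simpa using hl
    refine (hasSum_sibuyaWeight_mul_pow b hexp).congr_fun fun k ↦ ?_
    rw [← Real.exp_nat_mul]
    ring_nf

lemma tendsto_one_sub_exp_neg_mul_div (l : ℝ) :
    Tendsto (fun c : ℝ ↦ (1 - Real.exp (-(c * l))) / c) (𝓝[≠] 0) (𝓝 l) := by
  have h : HasDerivAt (fun c : ℝ ↦ 1 - Real.exp (-(c * l))) l 0 := by
    simpa using (((hasDerivAt_id (0 : ℝ)).mul_const l).neg.exp).const_sub 1
  refine h.tendsto_slope.congr fun c ↦ ?_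
  simp [slope_def_field]

lemma tendsto_sibuya_pow {b : ℝ} (hb : 0 < b) {l : ℝ} (hl : 0 ≤ l) :
    Tendsto (fun n : ℕ ↦ (1 - (1 - Real.exp (-((n : ℝ) ^ (-b⁻¹) * l))) ^ b) ^ n) atTop
      (𝓝 (Real.exp (-l ^ b))) := by
  have hscale : Tendsto (fun n : ℕ ↦ (n : ℝ) ^ (-b⁻¹)) atTop (𝓝[≠] 0) := by
    refine tendsto_nhdsWithin_iff.2
      ⟨(tendsto_rpow_neg_atTop (by positivity)).comp tendsto_natCast_atTop_atTop, ?_⟩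
    filter_upwards [eventually_gt_atTop 0] with n hn
    have : (0 : ℝ) < n := by exact_mod_cast hn
    exact (by positivity : (0 : ℝ) < (n : ℝ) ^ (-b⁻¹)).ne'
  simp_rw [sub_eq_add_neg (1 : ℝ) (_ ^ b)]
  refine Real.tendsto_one_add_pow_exp_of_tendsto ?_
  refine (((tendsto_one_sub_exp_neg_mul_div l).comp hscale).rpow_const
    (Or.inr hb.le)).neg.congr' ?_
  filter_upwards [eventually_gt_atTop 0] with n hn
  have hn' : (0 : ℝ) < n := by exact_mod_cast hn
  have hexp : Real.exp (-((n : ℝ) ^ (-b⁻¹) * l)) ≤ 1 :=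
    Real.exp_le_one_iff.2 (neg_nonpos.2 (by positivity))
  rw [Function.comp_apply, Real.div_rpow (by linarith) (by positivity), ← Real.rpow_mul hn'.le,
    neg_mul, inv_mul_cancel₀ hb.ne', Real.rpow_neg_one, div_inv_eq_mul]
  ring

lemma isLaplaceTransform_exp_neg_rpow {b : ℝ} (hb : 0 < b) (hb₁ : b ≤ 1) :
    IsLaplaceTransform fun l ↦ Real.exp (-l ^ b) := by
  have hcont : Continuous fun l : ℝ ↦ Real.exp (-l ^ b) := by
    have := Real.continuous_rpow_const hb.le
    fun_prop
  refine isLaplaceTransform_of_tendsto (fun n ↦ ?_)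
    (fun l hl ↦ (tendsto_sibuya_pow hb hl).comp (tendsto_add_atTop_nat 1))
    hcont.continuousWithinAt (Real.tendsto_exp_neg_atTop_nhds_zero.comp (tendsto_rpow_atTop hb))
  exact ((isLaplaceTransform_sibuya hb hb₁).comp_mul_left (by positivity)).pow n.succ_ne_zero

/-! ### Gamma laws and subordination -/

lemma setIntegral_Ioi_gammaPDFReal {t : ℝ} (ht : 0 < t) {l : ℝ} (hl : 0 ≤ l) :
    ∫ s in Set.Ioi 0, gammaPDFReal t 1 s * Real.exp (-(l * s)) = (1 + l) ^ (-t) := by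
  have hΓ : Real.Gamma t ≠ 0 := (Real.Gamma_pos_of_pos ht).ne'
  have hcongr : ∀ s ∈ Set.Ioi (0 : ℝ), gammaPDFReal t 1 s * Real.exp (-(l * s)) =
      (Real.Gamma t)⁻¹ * (s ^ (t - 1) * Real.exp (-((1 + l) * s))) := by
    intro s (hs : 0 < s)
    rw [gammaPDFReal, if_pos hs.le, Real.one_rpow, one_div, mul_assoc, mul_assoc, ← Real.exp_add]
    ring_nf
  rw [setIntegral_congr_fun measurableSet_Ioi hcongr, integral_const_mul,
    Real.integral_rpow_mul_exp_neg_mul_Ioi ht (by positivity), one_div,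
    Real.inv_rpow (by positivity), Real.rpow_neg (by positivity)]
  field_simp

lemma gammaPDFReal_of_neg (a r : ℝ) {x : ℝ} (hx : x < 0) : gammaPDFReal a r x = 0 :=
  if_neg hx.not_ge

lemma measurable_gammaPDF (a r : ℝ) : Measurable (gammaPDF a r) :=
  (measurable_gammaPDFReal a r).ennreal_ofReal

lemma ae_gammaMeasure_pos (a r : ℝ) : ∀ᵐ x ∂gammaMeasure a r, 0 < x := by
  rw [gammaMeasure, ae_withDensity_iff (measurable_gammaPDF a r)]
  filter_upwards [Measure.ae_ne volume (0 : ℝ)] with x hx hpdf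
  contrapose! hpdf
  exact gammaPDF_of_neg (hpdf.lt_of_ne hx)

lemma isLaplaceTransform_gamma {t : ℝ} (ht : 0 < t) :
    IsLaplaceTransform fun l ↦ (1 + l) ^ (-t) := by
  refine ⟨gammaMeasure t 1, isProbabilityMeasure_gammaMeasure ht zero_lt_one,
    ae_gammaMeasure_pos t 1, fun l hl ↦ ?_⟩
  beta_reduce
  rw [← setIntegral_Ioi_gammaPDFReal ht hl, gammaMeasure,
    integral_withDensity_eq_integral_toReal_smul (measurable_gammaPDF t 1)
      (ae_of_all _ fun _ ↦ ENNReal.ofReal_lt_top)]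
  simp_rw [gammaPDF, ENNReal.toReal_ofReal (gammaPDFReal_nonneg ht zero_lt_one _), smul_eq_mul]
  refine (setIntegral_eq_integral_of_ae_compl_eq_zero ?_).symm
  filter_upwards [Measure.ae_ne volume (0 : ℝ)] with x hx hx'
  rw [gammaPDFReal_of_neg t 1 ((not_lt.1 hx').lt_of_ne hx), zero_mul]

/-- If `S` and `T` are independent, `T` has Laplace transform `f` and `S` is one-sided `b`-stable,
then `T ^ (1 / b) * S` has Laplace transform `l ↦ f (l ^ b)`. -/
lemma IsLaplaceTransform.comp_rpow {f : ℝ → ℝ} (hf : IsLaplaceTransform f) {b : ℝ} (hb : 0 < b)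
    (hb₁ : b ≤ 1) : IsLaplaceTransform fun l ↦ f (l ^ b) := by
  obtain ⟨τ, _, hτ₀, hτ⟩ := hf
  obtain ⟨σ, _, hσ₀, hσ⟩ := isLaplaceTransform_exp_neg_rpow hb hb₁
  beta_reduce at hσ
  have hpos : ∀ᵐ q ∂τ.prod σ, 0 < q.1 ^ b⁻¹ * q.2 := by
    filter_upwards [Measure.quasiMeasurePreserving_fst.ae hτ₀,
      Measure.quasiMeasurePreserving_snd.ae hσ₀] with q h₁ h₂
    positivity
  refine isLaplaceTransform_of_integral (P := τ.prod σ) (X := fun q ↦ q.1 ^ b⁻¹ * q.2)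
    (by fun_prop) hpos fun l hl ↦ ?_
  rw [integral_prod _ (integrable_exp_neg_mul (by fun_prop) (hpos.mono fun _ ↦ le_of_lt) hl),
    ← hτ _ (by positivity)]
  refine integral_congr_ae ?_
  filter_upwards [hτ₀] with s hs
  simp_rw [← mul_assoc]
  rw [hσ _ (by positivity), Real.mul_rpow hl (by positivity), Real.rpow_inv_rpow hs.le hb.ne']

/-! ### Gaussian mixtures -/

section GaussianMixture

variable {E : Type*} [NormedAddCommGroup E] [InnerProductSpace ℝ E] [FiniteDimensional ℝ E]
  [MeasurableSpace E] [BorelSpace E]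

lemma charFun_withDensity_exp_neg_half_mul_sq_norm (ξ : E) :
    charFun (volume.withDensity fun v : E ↦ ENNReal.ofReal (Real.exp (-(1 / 2) * ‖v‖ ^ 2))) ξ =
      (2 * Real.pi) ^ (Module.finrank ℝ E / 2 : ℂ) * Complex.exp (-‖ξ‖ ^ 2 / 2) := by
  have h := GaussianFourier.integral_cexp_neg_mul_sq_norm_add (b := 1 / 2) (by norm_num)
    Complex.I ξ
  rw [Complex.I_sq] at h
  rw [charFun_apply, integral_withDensity_eq_integral_toReal_smul (by fun_prop)
    (ae_of_all _ fun _ ↦ ENNReal.ofReal_lt_top)]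
  convert! h using 2
  · ext v
    rw [ENNReal.toReal_ofReal (Real.exp_nonneg _), Complex.real_smul, Complex.ofReal_exp,
      ← Complex.exp_add, real_inner_comm]
    push_cast
    ring_nf
  · ring_nf
  · ring_nf

lemma stdGaussian_absolutelyContinuous : stdGaussian E ≪ (volume : Measure E) := by
  set g : E → ℝ := fun v ↦ Real.exp (-(1 / 2) * ‖v‖ ^ 2)
  have hg : Integrable g := by
    refine Integrable.of_integral_ne_zero ?_
    rw [GaussianFourier.integral_rexp_neg_mul_sq_norm (by norm_num)]
    positivity
  have := isFiniteMeasure_withDensity_ofReal hg.2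
  set c : ℝ≥0 := Real.toNNReal ((2 * Real.pi) ^ (Module.finrank ℝ E / 2 : ℝ)) with hc
  have hc₀ : (c : ℝ≥0∞) ≠ 0 := by
    rw [hc, ENNReal.coe_ne_zero, ne_eq, Real.toNNReal_eq_zero, not_le]
    positivity
  have hdensity : volume.withDensity (fun v ↦ ENNReal.ofReal (g v)) = c • stdGaussian E := by
    refine Measure.ext_of_charFun (funext fun ξ ↦ ?_)
    rw [charFun_withDensity_exp_neg_half_mul_sq_norm, charFun_apply,
      integral_smul_nnreal_measure, ← charFun_apply, charFun_stdGaussian, NNReal.smul_def, hc,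
      Real.coe_toNNReal _ (by positivity), Complex.real_smul, Complex.ofReal_cpow (by positivity)]
    push_cast
    rfl
  exact ((Measure.absolutelyContinuous_smul hc₀).trans hdensity.symm.absolutelyContinuous).trans
    (withDensity_absolutelyContinuous _ _)

lemma charFun_map_sqrt_smul_stdGaussian {m : Measure ℝ} [IsFiniteMeasure m]
    (hm : ∀ᵐ u ∂m, 0 ≤ u) (ξ : E) :
    charFun ((m.prod (stdGaussian E)).map fun q ↦ √(2 * q.1) • q.2) ξ =
      ((∫ u, Real.exp (-(‖ξ‖ ^ 2 * u)) ∂m : ℝ) : ℂ) := by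
  have hintegrable : Integrable (fun q : ℝ × E ↦
      Complex.exp (inner ℝ (√(2 * q.1) • q.2) ξ * Complex.I)) (m.prod (stdGaussian E)) :=
    Integrable.of_bound (C := 1) (by fun_prop)
      (ae_of_all _ fun q ↦ (Complex.norm_exp_ofReal_mul_I _).le)
  rw [charFun_apply, integral_map (by fun_prop) (by fun_prop), integral_prod _ hintegrable,
    ← integral_complex_ofReal]
  refine integral_congr_ae ?_
  filter_upwards [hm] with u hu
  calc ∫ z, Complex.exp (inner ℝ (√(2 * u) • z) ξ * Complex.I) ∂stdGaussian E
      = charFun (stdGaussian E) (√(2 * u) • ξ) := by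
        simp_rw [charFun_apply, real_inner_smul_left, real_inner_smul_right]
    _ = (Real.exp (-(‖ξ‖ ^ 2 * u)) : ℂ) := by
        rw [charFun_stdGaussian, norm_smul, Real.norm_of_nonneg (Real.sqrt_nonneg _),
          Complex.ofReal_exp, ← Complex.ofReal_pow, mul_pow, Real.sq_sqrt (by positivity)]
        push_cast
        ring_nf

lemma map_sqrt_smul_stdGaussian_absolutelyContinuous {m : Measure ℝ} (hm : ∀ᵐ u ∂m, 0 < u) :
    (m.prod (stdGaussian E)).map (fun q ↦ √(2 * q.1) • q.2) ≪ (volume : Measure E) := by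
  have hmeas : Measurable fun q : ℝ × E ↦ √(2 * q.1) • q.2 := by fun_prop
  refine Measure.AbsolutelyContinuous.mk fun s hs hs₀ ↦ ?_
  rw [Measure.map_apply hmeas hs, Measure.measure_prod_null (hmeas hs)]
  filter_upwards [hm] with u hu
  refine stdGaussian_absolutelyContinuous ?_
  change volume ((√(2 * u) • · : E → E) ⁻¹' s) = 0
  rw [Measure.addHaar_preimage_smul _ (by positivity), hs₀, mul_zero]

variable (E) in
lemma IsLaplaceTransform.exists_charFun_eq {f : ℝ → ℝ} (hf : IsLaplaceTransform f) :
    ∃ ν : Measure E, IsProbabilityMeasure ν ∧ ν ≪ volume ∧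
      ∀ ξ, charFun ν ξ = (f (‖ξ‖ ^ 2) : ℂ) := by
  obtain ⟨m, _, hm₀, hm⟩ := hf
  refine ⟨_, Measure.isProbabilityMeasure_map (by fun_prop),
    map_sqrt_smul_stdGaussian_absolutelyContinuous hm₀, fun ξ ↦ ?_⟩
  rw [charFun_map_sqrt_smul_stdGaussian (hm₀.mono fun _ ↦ le_of_lt), hm _ (by positivity)]

variable (E) in
lemma exists_charFun_eq_one_add_norm_rpow {α t : ℝ} (hα₀ : 0 < α) (hα₂ : α ≤ 2) (ht : 0 < t) :
    ∃ ν : Measure E, IsProbabilityMeasure ν ∧ ν ≪ volume ∧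
      ∀ ξ, charFun ν ξ = (((1 + ‖ξ‖ ^ α) ^ (-t) : ℝ) : ℂ) := by
  have hlaplace : IsLaplaceTransform fun l ↦ (1 + l ^ (α / 2)) ^ (-t) :=
    (isLaplaceTransform_gamma ht).comp_rpow (by positivity) (by linarith)
  have hpow (r : ℝ) (hr : 0 ≤ r) : (r ^ 2) ^ (α / 2) = r ^ α := by
    rw [← Real.rpow_natCast, ← Real.rpow_mul hr, Nat.cast_ofNat, mul_div_cancel₀ α two_ne_zero]
  simpa only [hpow _ (norm_nonneg _)] using hlaplace.exists_charFun_eq E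

end GaussianMixture

/-! ### Failure of integrability for small times -/

section Integrability

variable {E : Type*} [NormedAddCommGroup E] [NormedSpace ℝ E] [FiniteDimensional ℝ E]
  [MeasurableSpace E] [BorelSpace E] (μ : Measure E) [μ.IsAddHaarMeasure]

lemma not_integrableOn_norm_rpow_neg_finrank [Nontrivial E] :
    ¬ IntegrableOn (fun x : E ↦ ‖x‖ ^ (-(Module.finrank ℝ E : ℝ))) {x | 1 < ‖x‖} μ := by
  intro h
  rw [← integrable_indicator_iff (measurableSet_lt measurable_const measurable_norm)] at h
  have hradial := (integrable_fun_norm_addHaar μ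
    (f := (Set.Ioi 1).indicator fun r : ℝ ↦ r ^ (-(Module.finrank ℝ E : ℝ)))).1 h
  refine lt_irrefl (-1 : ℝ) ((integrableOn_Ioi_rpow_iff zero_lt_one).1 ?_)
  refine (hradial.mono_set (Set.Ioi_subset_Ioi zero_le_one)).congr_fun (fun r hr ↦ ?_)
    measurableSet_Ioi
  have hr₀ : 0 < r := zero_lt_one.trans hr
  beta_reduce
  rw [Set.indicator_of_mem hr, smul_eq_mul, ← Real.rpow_natCast, ← Real.rpow_add hr₀,
    Nat.cast_sub Module.finrank_pos]
  ring_nf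

lemma rpow_neg_mul_le_mul_one_add_rpow {α t r : ℝ} (hα : 0 ≤ α) (ht : 0 ≤ t) (hr : 1 ≤ r) :
    r ^ (-(α * t)) ≤ 2 ^ t * (1 + r ^ α) ^ (-t) := by
  have hr₀ : 0 < r := zero_lt_one.trans_le hr
  calc r ^ (-(α * t)) = 2 ^ t * (2 * r ^ α) ^ (-t) := by
        rw [Real.mul_rpow zero_le_two (by positivity), ← Real.rpow_mul hr₀.le, mul_neg,
          ← mul_assoc, ← Real.rpow_add zero_lt_two, add_neg_cancel, Real.rpow_zero, one_mul]
    _ ≤ 2 ^ t * (1 + r ^ α) ^ (-t) := by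
        refine mul_le_mul_of_nonneg_left ?_ (by positivity)
        refine Real.rpow_le_rpow_of_nonpos (by positivity) ?_ (neg_nonpos.2 ht)
        linarith [Real.one_le_rpow hr hα]

lemma not_integrable_one_add_norm_rpow {α t : ℝ} (hα : 0 < α) (ht : 0 < t)
    (h : t ≤ Module.finrank ℝ E / α) : ¬ Integrable (fun x : E ↦ (1 + ‖x‖ ^ α) ^ (-t)) μ := by
  have hfinrank : α * t ≤ Module.finrank ℝ E := by rwa [le_div_iff₀' hα] at h
  have : Nontrivial E := Module.finrank_pos_iff (R := ℝ).1 <| by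
    exact_mod_cast (mul_pos hα ht).trans_le hfinrank
  refine fun hint ↦ not_integrableOn_norm_rpow_neg_finrank μ
    ((hint.const_mul (2 ^ t)).integrableOn.mono'
      (measurable_norm.pow_const _).aestronglyMeasurable ?_)
  filter_upwards [ae_restrict_mem (measurableSet_lt measurable_const measurable_norm)]
    with x (hx : 1 < ‖x‖)
  rw [Real.norm_of_nonneg (by positivity)]
  exact (Real.rpow_le_rpow_of_exponent_le hx.le (neg_le_neg hfinrank)).trans
    (rpow_neg_mul_le_mul_one_add_rpow hα.le ht.le hx.le)

end Integrability

/-! ### Transition densities -/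

lemma exists_withDensity_ofReal_eq {X : Type*} [MeasurableSpace X] {μ ν : Measure X}
    [SigmaFinite μ] [SigmaFinite ν] (h : ν ≪ μ) :
    ∃ q : X → ℝ, Measurable q ∧ (∀ y, 0 ≤ q y) ∧
      μ.withDensity (fun y ↦ ENNReal.ofReal (q y)) = ν := by
  refine ⟨fun y ↦ (ν.rnDeriv μ y).toReal, by fun_prop, fun _ ↦ ENNReal.toReal_nonneg, ?_⟩
  rw [withDensity_congr_ae (g := ν.rnDeriv μ), Measure.withDensity_rnDeriv_eq _ _ h]
  filter_upwards [Measure.rnDeriv_lt_top ν μ] with y hy using ENNReal.ofReal_toReal hy.ne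

lemma map_const_add_withDensity {G : Type*} [AddCommGroup G] [MeasurableSpace G]
    [MeasurableAdd G] (μ : Measure G) [μ.IsAddLeftInvariant] (f : G → ℝ≥0∞) (x : G) :
    (μ.withDensity f).map (x + ·) = μ.withDensity (fun y ↦ f (y - x)) := by
  ext s hs
  have hx : Measurable fun y : G ↦ x + y := measurable_const_add x
  rw [Measure.map_apply hx hs, withDensity_apply _ (hx hs), withDensity_apply _ hs,
    ← (measurePreserving_add_left μ x).setLIntegral_comp_preimage_emb
      (MeasurableEquiv.addLeft x).measurableEmbedding (fun y ↦ f (y - x)) s]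
  simp only [add_sub_cancel_left]

lemma IsGeometricStableProcess.charFun_map {d : ℕ} {Ω : Type*} [MeasurableSpace Ω] {α : ℝ}
    {L : ℝ≥0 → Ω → EuclideanSpace ℝ (Fin d)} {P : Measure Ω}
    (hL : IsGeometricStableProcess α L P) (t : ℝ≥0) (ξ : EuclideanSpace ℝ (Fin d)) :
    charFun (P.map (L t)) ξ = (((1 + ‖ξ‖ ^ α) ^ (-(t : ℝ)) : ℝ) : ℂ) := by
  rw [hL.hasSymbol, Real.rpow_def_of_pos (by positivity)]
  simp only [geometricStableSymbol]
  push_cast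
  ring_nf

theorem theorem3p4_general (E : Type*) [NormedAddCommGroup E] [InnerProductSpace ℝ E]
    [FiniteDimensional ℝ E] [MeasurableSpace E] [BorelSpace E] {α : ℝ} (hα₀ : 0 < α)
    (hα₂ : α ≤ 2) :
    (∃ p : ℝ≥0 → E → ℝ,
      (∀ t, 0 < t → Measurable (p t) ∧ ∀ y, 0 ≤ p t y) ∧
      (∀ t, 0 < t →
        IsProbabilityMeasure (volume.withDensity fun y ↦ ENNReal.ofReal (p t y)) ∧
        ∀ ξ, charFun (volume.withDensity fun y ↦ ENNReal.ofReal (p t y)) ξ =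
          (((1 + ‖ξ‖ ^ α) ^ (-(t : ℝ)) : ℝ) : ℂ)) ∧
      ∀ (Ω : Type*) [MeasurableSpace Ω] (P : Measure Ω) [IsFiniteMeasure P] (Z : Ω → E),
        AEMeasurable Z P → ∀ t : ℝ≥0, 0 < t →
        (∀ ξ, charFun (P.map Z) ξ = (((1 + ‖ξ‖ ^ α) ^ (-(t : ℝ)) : ℝ) : ℂ)) →
        ∀ x, P.map (fun ω ↦ x + Z ω) =
          volume.withDensity fun y ↦ ENNReal.ofReal (p t (y - x))) ∧
    ∀ t : ℝ≥0, 0 < t → (t : ℝ) ≤ Module.finrank ℝ E / α →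
      ¬ Integrable (fun ξ : E ↦ (1 + ‖ξ‖ ^ α) ^ (-(t : ℝ))) := by
  refine ⟨?_, fun t ht h ↦ not_integrable_one_add_norm_rpow volume hα₀ ht h⟩
  choose! ν hprob hac hchar using fun (t : ℝ≥0) (ht : 0 < t) ↦
    exists_charFun_eq_one_add_norm_rpow E hα₀ hα₂ (NNReal.coe_pos.2 ht)
  choose! p hmeas hp₀ hp using fun (t : ℝ≥0) (ht : 0 < t) ↦
    have := hprob t ht
    exists_withDensity_ofReal_eq (hac t ht)
  refine ⟨p, fun t ht ↦ ⟨hmeas t ht, hp₀ t ht⟩, fun t ht ↦ hp t ht ▸ ⟨hprob t ht, hchar t ht⟩,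
    fun Ω _ P _ Z hZ t ht hZchar x ↦ ?_⟩
  have := hprob t ht
  have hlaw : P.map Z = ν t :=
    Measure.ext_of_charFun (funext fun ξ ↦ (hZchar ξ).trans (hchar t ht ξ).symm)
  rw [← map_const_add_withDensity volume (fun y ↦ ENNReal.ofReal (p t y)), hp t ht, ← hlaw,
    AEMeasurable.map_map_of_aemeasurable (by fun_prop) hZ, Function.comp_def]

theorem theorem3p4 (d : ℕ) (hd : 1 ≤ d) (α : ℝ) (hα₀ : 0 < α) (hα₂ : α ≤ 2) :
    -- there are Borel functions `p t ≥ 0`, `t > 0`, such that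
    (∃ p : ℝ≥0 → EuclideanSpace ℝ (Fin d) → ℝ,
      (∀ t, 0 < t → Measurable (p t) ∧ (∀ y, 0 ≤ p t y)) ∧
      -- `p t (y) dy` is a probability measure with Fourier transform `(1 + |ξ|^α)^(-t)`,
      (∀ t, 0 < t →
        IsProbabilityMeasure (volume.withDensity (fun y ↦ ENNReal.ofReal (p t y))) ∧
        ∀ ξ, charFun (volume.withDensity (fun y ↦ ENNReal.ofReal (p t y))) ξ =
          (((1 + ‖ξ‖ ^ α) ^ (-(t : ℝ)) : ℝ) : ℂ)) ∧
      -- and `p t (y - x)` is the transition density of every geometric `α`-stable process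
      (∀ (Ω : Type*) [MeasurableSpace Ω] (P : Measure Ω)
        (L : ℝ≥0 → Ω → EuclideanSpace ℝ (Fin d)), IsGeometricStableProcess α L P →
        ∀ t, 0 < t → ∀ x : EuclideanSpace ℝ (Fin d),
          P.map (fun ω ↦ x + L t ω) =
            volume.withDensity (fun y ↦ ENNReal.ofReal (p t (y - x))))) ∧
    -- for small `t` the characteristic function is not integrable
    (∀ t : ℝ≥0, 0 < t → (t : ℝ) ≤ d / α →
      ¬ Integrable (fun ξ : EuclideanSpace ℝ (Fin d) ↦ (1 + ‖ξ‖ ^ α) ^ (-(t : ℝ)))) := by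
  obtain ⟨⟨p, hp, hpchar, hlaw⟩, hint⟩ :=
    theorem3p4_general (EuclideanSpace ℝ (Fin d)) hα₀ hα₂
  refine ⟨⟨p, hp, hpchar, fun Ω _ P L hL t ht ↦ ?_⟩,
    fun t ht h ↦ hint t ht (by rwa [finrank_euclideanSpace_fin])⟩
  have := hL.isLevyProcess.isProbabilityMeasure
  exact hlaw Ω P (L t) (hL.isLevyProcess.measurable t).aemeasurable t ht (hL.charFun_map t)
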